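/- Let $V$ be a finite set of nodes and $K=|V|$. A *gate* over $V$ is a 5-tuple $T=(G,v_1,v_2,v,\alpha)$ with type $G\in\{G_\zeta,G_{\times\zeta},G_=,G_+,G_-,G_<,G_\land,G_\lor,G_\lnot\}$, input nodes $v_1,v_2\in V\cup\{nil\}$, output node $v\in V$ and $\alpha\in\mathbb R\cup\{nil\}$, such that: - if $G=G_\zeta$, then $v_1=v_2=nil$ and $\alpha\in\mathbb R$ with $0\le\alpha\le 1/K$; - if $G=G_{\times\zeta}$, then $v_1\in V$, $v_2=nil$ and $\alpha\in\mathbb R$ with $0\le\alpha\le 1$; - if $G\in\{G_=,G_\lnot\}$, then $v_1\in V$ and $v_2=\alpha=nil$; - if $G\in\{G_+,G_-,G_<,G_\land,G_\lor\}$, then $v_1,v_2\in V$, $v_1\ne v_2$ and $\alpha=nil$. A *generalized circuit* $\mathcal S=(V,\mathcal T)$ consists of $V$ and a set $\mathcal T$ of gates over $V$, any two distinct gates of which have different output nodes (directed cycles are allowed). For $\varepsilon\ge 0$ and real numbers $a,b$ write $a=b\pm\varepsilon$ if $b-\varepsilon\le a\le b+\varepsilon$; write $a=^\varepsilon_B 1$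 if $1/K-\varepsilon\le a\le 1/K+\varepsilon$, and $a=^\varepsilon_B 0$ if $0\le a\le\varepsilon$. An *$\varepsilon$-approximate solution* of $\mathcal S$ is an assignment $x:V\to\mathbb R$ such that $0\le x[v]\le 1/K+\varepsilon$ for all $v\in V$ and, for every gate $(G,v_1,v_2,v,\alpha)\in\mathcal T$: - $G_\zeta$: $x[v]=\alpha\pm\varepsilon$; - $G_{\times\zeta}$: $x[v]=\min(\alpha x[v_1],1/K)\pm\varepsilon$; - $G_=$: $x[v]=\min(x[v_1],1/K)\pm\varepsilon$; - $G_+$: $x[v]=\min(x[v_1]+x[v_2],1/K)\pm\varepsilon$; - $G_-$: $\min(x[v_1]-x[v_2],1/K)-\varepsilon\le x[v]\le\max(x[v_1]-x[v_2],0)+\varepsilon$; - $G_<$: $x[v]=^\varepsilon_B1$ if $x[v_1]<x[v_2]-\varepsilon$, and $x[v]=^\varepsilon_B0$ if $x[v_1]>x[v_2]+\varepsilon$; - $G_\lor$: $x[v]=^\varepsilon_B1$ if $x[v_1]=^\varepsilon_B1$ or $x[v_2]=^\varepsilon_B1$, and $x[v]=^\varepsilon_B0$ if $x[v_1]=^\varepsilon_B0$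 and $x[v_2]=^\varepsilon_B0$; - $G_\land$: $x[v]=^\varepsilon_B0$ if $x[v_1]=^\varepsilon_B0$ or $x[v_2]=^\varepsilon_B0$, and $x[v]=^\varepsilon_B1$ if $x[v_1]=^\varepsilon_B1$ and $x[v_2]=^\varepsilon_B1$; - $G_\lnot$: $x[v]=^\varepsilon_B0$ if $x[v_1]=^\varepsilon_B1$, and $x[v]=^\varepsilon_B1$ if $x[v_1]=^\varepsilon_B0$. **Theorem.** For every real constant $c>0$, every generalized circuit $\mathcal S=(V,\mathcal T)$ has a $1/|V|^c$-approximate solution. (If $V=\emptyset$ there is nothing to satisfy.) -/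

import Mathlib

namespace GeneralizedCircuit

/-- The nine gate types `G_ζ, G_{×ζ}, G_=, G_+, G_-, G_<, G_∧, G_∨, G_¬`. -/
inductive GateType : Type
  | const | scale | copy | plus | minus | less | conj | disj | neg

/-- A gate is a 5-tuple `(G, v₁, v₂, v, α)`; the value `none` plays the role of *nil*. -/
@[ext]
structure Gate (V : Type*) where
  type : GateType
  fst : Option V
  snd : Option V
  out : V
  param : Option ℝ

/-- The syntactic conditions on a gate `(G, v₁, v₂, v, α)` over the node set `V`. -/
def Gate.IsValid {V : Type*} [Fintype V] (T : Gate V) : Prop :=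
  match T.type with
  | .const => T.fst = none ∧ T.snd = none ∧
      ∃ α : ℝ, T.param = some α ∧ 0 ≤ α ∧ α ≤ 1 / (Fintype.card V : ℝ)
  | .scale => (∃ v₁ : V, T.fst = some v₁) ∧ T.snd = none ∧
      ∃ α : ℝ, T.param = some α ∧ 0 ≤ α ∧ α ≤ 1
  | .copy | .neg => (∃ v₁ : V, T.fst = some v₁) ∧ T.snd = none ∧ T.param = none
  | .plus | .minus | .less | .conj | .disj =>
      (∃ v₁ v₂ : V, T.fst = some v₁ ∧ T.snd = some v₂ ∧ v₁ ≠ v₂) ∧ T.param = none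

/-- `a = b ± ε`. -/
def Approx (ε a b : ℝ) : Prop := b - ε ≤ a ∧ a ≤ b + ε

/-- With `K` nodes, the value `a` represents boolean `1` with precision `ε`. -/
def IsOne (K : ℕ) (ε a : ℝ) : Prop := 1 / (K : ℝ) - ε ≤ a ∧ a ≤ 1 / (K : ℝ) + ε

/-- The value `a` represents boolean `0` with precision `ε`. -/
def IsZero (ε a : ℝ) : Prop := 0 ≤ a ∧ a ≤ ε

/-- The constraint `P[T, ε]` that a gate `T` imposes on an assignment `x`. The last case
does not occur for valid gates. -/
def Gate.Constraint {V : Type*} [Fintype V] (T : Gate V) (ε : ℝ) (x : V → ℝ) : Prop :=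
  match T with
  | ⟨.const, none, none, v, some α⟩ => Approx ε (x v) α
  | ⟨.scale, some v₁, none, v, some α⟩ =>
      Approx ε (x v) (min (α * x v₁) (1 / (Fintype.card V : ℝ)))
  | ⟨.copy, some v₁, none, v, none⟩ =>
      Approx ε (x v) (min (x v₁) (1 / (Fintype.card V : ℝ)))
  | ⟨.plus, some v₁, some v₂, v, none⟩ =>
      Approx ε (x v) (min (x v₁ + x v₂) (1 / (Fintype.card V : ℝ)))
  | ⟨.minus, some v₁, some v₂, v, none⟩ =>
      min (x v₁ - x v₂) (1 / (Fintype.card V : ℝ)) - ε ≤ x v ∧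
        x v ≤ max (x v₁ - x v₂) 0 + ε
  | ⟨.less, some v₁, some v₂, v, none⟩ =>
      (x v₁ < x v₂ - ε → IsOne (Fintype.card V) ε (x v)) ∧
        (x v₁ > x v₂ + ε → IsZero ε (x v))
  | ⟨.disj, some v₁, some v₂, v, none⟩ =>
      (IsOne (Fintype.card V) ε (x v₁) ∨ IsOne (Fintype.card V) ε (x v₂) →
          IsOne (Fintype.card V) ε (x v)) ∧
        (IsZero ε (x v₁) ∧ IsZero ε (x v₂) → IsZero ε (x v))
  | ⟨.conj, some v₁, some v₂, v, none⟩ =>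
      (IsZero ε (x v₁) ∨ IsZero ε (x v₂) → IsZero ε (x v)) ∧
        (IsOne (Fintype.card V) ε (x v₁) ∧ IsOne (Fintype.card V) ε (x v₂) →
          IsOne (Fintype.card V) ε (x v))
  | ⟨.neg, some v₁, none, v, none⟩ =>
      (IsOne (Fintype.card V) ε (x v₁) → IsZero ε (x v)) ∧
        (IsZero ε (x v₁) → IsOne (Fintype.card V) ε (x v))
  | _ => False

/-- A generalized circuit with node set `V`: a collection of valid gates, any two of which
have different output nodes. Cycles are allowed. -/
structure Circuit (V : Type*) [Fintype V] where
  gates : Set (Gate V)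
  valid : ∀ T ∈ gates, T.IsValid
  out_ne : ∀ T ∈ gates, ∀ T' ∈ gates, T ≠ T' → T.out ≠ T'.out

/-- `x` is an `ε`-approximate solution of the generalized circuit `S`. -/
def Circuit.IsApproxSolution {V : Type*} [Fintype V] (S : Circuit V) (ε : ℝ)
    (x : V → ℝ) : Prop :=
  (∀ v : V, 0 ≤ x v ∧ x v ≤ 1 / (Fintype.card V : ℝ) + ε) ∧
    ∀ T ∈ S.gates, T.Constraint ε x

end GeneralizedCircuit

/-! Each node has at most one gate, so a circuit amounts to simultaneous equations `x v = g v x`.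
The functions `g v` can be taken continuous with values in `[0, 1/K]`. The arithmetic gates are
already continuous after truncation, while the comparison and boolean gates leave a region of width
governed by `ε` in which a continuous function may interpolate. There are `K` coordinates, each at
most `1/K`, so their sum is at most `1`. A slack coordinate turns the joint update into a self-map
of the standard simplex, and Brouwer's theorem gives a fixed point, which solves the circuit. Only
`ε > 0` matters; the exponent plays no other role.

Brouwer's theorem is derived from Scarf's combinatorial lemma
(`Scarf.exists_dominant_image_eq_univ`): a parity count of facets of dominant sets produces a
dominant set with all colours. On a simplicial grid this is a discrete KKM lemma
(`Scarf.exists_grid_point`), and compactness passes to the limit. -/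

namespace Scarf

/-! ### Dominant sets and their one-element extensions -/

open Finset

/-- No element of `X` lies strictly above `S` in all of the orders given by `r`. -/
def Dominant {ι X L : Type*} [LinearOrder L] (r : ι → X → L) (S : Finset X) : Prop :=
  ∀ x, ∃ i, ∀ s ∈ S, r i x ≤ r i s

variable {ι X L : Type*} [LinearOrder L] {r : ι → X → L}

theorem Dominant.mono {S τ : Finset X} (hS : Dominant r S) (h : τ ⊆ S) : Dominant r τ :=
  fun x => (hS x).imp fun _ hi s hs => hi s (h hs)

/-- `y` is the last element, in the order `j`, of those above `m i` in each order `i ≠ j`. -/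
def IsReplacement (r : ι → X → L) (m : ι → X) (j : ι) (y : X) : Prop :=
  (∀ i, i ≠ j → r i (m i) < r i y) ∧
    ∀ t, (∀ i, i ≠ j → r i (m i) < r i t) → r j t ≤ r j y

theorem exists_isReplacement [Finite X] {m : ι → X} {j : ι} {y : X}
    (hy : ∀ i, i ≠ j → r i (m i) < r i y) : ∃ z, IsReplacement r m j z := by
  obtain ⟨z, hz, hmax⟩ := Set.exists_max_image {t | ∀ i, i ≠ j → r i (m i) < r i t} (r j)
    (Set.toFinite _) ⟨y, hy⟩
  exact ⟨z, hz, hmax⟩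

theorem IsReplacement.unique (hr : ∀ i, Function.Injective (r i)) {m : ι → X} {j : ι} {y z : X}
    (hy : IsReplacement r m j y) (hz : IsReplacement r m j z) : y = z :=
  hr j (le_antisymm (hz.2 y hy.1) (hy.2 z hz.1))

/-- The data attached to a dominant set with one element less than there are orders: the
minimum `m i` in each order, and the only two orders `a`, `b` that share their minimum. -/
structure Minima (r : ι → X → L) (τ : Finset X) (m : ι → X) (a b : ι) : Prop where
  mem : ∀ i, m i ∈ τ
  le : ∀ i, ∀ s ∈ τ, r i (m i) ≤ r i s
  ne : a ≠ b
  eq : m a = m b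
  eq_or : ∀ i j, m i = m j → i = j ∨ (i = a ∧ j = b) ∨ (i = b ∧ j = a)

/-- Dominance tested at `s` itself puts `s` below all of `τ` in some order. -/
theorem Dominant.exists_order_of_mem (hr : ∀ i, Function.Injective (r i)) {τ : Finset X}
    (hτ : Dominant r τ) {m : ι → X} (mem : ∀ i, m i ∈ τ) (le : ∀ i, ∀ s ∈ τ, r i (m i) ≤ r i s)
    {s : X} (hs : s ∈ τ) : ∃ i, m i = s := by
  obtain ⟨i, hi⟩ := hτ s
  exact ⟨i, hr i (le_antisymm (le i s hs) (hi _ (mem i)))⟩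

theorem Dominant.exists_minima [DecidableEq X] [Fintype ι] [DecidableEq ι] (hr : ∀ i, Function.Injective (r i))
    {τ : Finset X} (hτ : Dominant r τ) (hne : τ.Nonempty) (hcard : τ.card + 1 = Fintype.card ι) :
    ∃ m a b, Minima r τ m a b := by
  choose m mem le using fun i => exists_min_image τ (r i) hne
  have hlt : τ.card < (univ : Finset ι).card := by rw [card_univ]; omega
  obtain ⟨a, -, b, -, hab, h⟩ :=
    exists_ne_map_eq_of_card_lt_of_maps_to hlt (fun i _ => mem i)
  -- If `k` shares its minimum with `l`, then `m` still maps onto `τ` without `k`. The cardinalities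
  -- now agree, so `m` is injective there. Using this for `a` and for `b` excludes every other
  -- coincidence.
  have inj : ∀ k l, k ≠ l → m k = m l → ∀ i j, i ≠ k → j ≠ k → m i = m j → i = j := by
    intro k l hkl hm i j hi hj hij
    refine inj_on_of_surj_on_of_card_le (s := univ.erase k) (t := τ) (fun i _ => m i)
      (fun i _ => mem i) ?_ ?_ (by simpa using hi) (by simpa using hj) hij
    · intro s hs
      obtain ⟨i, rfl⟩ := hτ.exists_order_of_mem hr mem le hs
      by_cases hik : i = k
      · exact ⟨l, by simpa using hkl.symm, by rw [hik, hm]⟩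
      · exact ⟨i, by simpa using hik, rfl⟩
    · rw [card_erase_of_mem (mem_univ _), card_univ]; omega
  refine ⟨m, a, b, mem, le, hab, h, fun i j hij => ?_⟩
  have h1 := inj a b hab h i j
  have h2 := inj b a hab.symm h.symm i j
  grind

namespace Minima

variable {τ : Finset X} {m : ι → X} {a b : ι}

theorem symm (h : Minima r τ m a b) : Minima r τ m b a :=
  ⟨h.mem, h.le, h.ne.symm, h.eq.symm, fun i j hij => by have := h.eq_or i j hij; tauto⟩

/-- Dominance of `τ` at `y` gives an order in which `y` is below `τ`; a replacement beats the
minimum in every order but `a`, so that order is `a`. -/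
theorem lt_of_isReplacement (hr : ∀ i, Function.Injective (r i)) (hτ : Dominant r τ)
    (h : Minima r τ m a b) {y : X} (hy : IsReplacement r m a y) :
    y ∉ τ ∧ r a y < r a (m a) := by
  have hyτ : y ∉ τ := by
    intro hyτ
    obtain ⟨k, rfl⟩ := hτ.exists_order_of_mem hr h.mem h.le hyτ
    by_cases hk : k = a
    · have := hy.1 b h.ne.symm
      rw [hk, h.eq] at this
      exact lt_irrefl _ this
    · exact lt_irrefl _ (hy.1 k hk)
  obtain ⟨i, hi⟩ := hτ y
  by_cases hia : i = a
  · subst hia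
    refine ⟨hyτ, lt_of_le_of_ne (hi _ (h.mem i)) fun he => hyτ ?_⟩
    rw [hr i he]; exact h.mem i
  · exact absurd (hy.1 i hia) (not_lt.2 (hi _ (h.mem i)))

theorem not_isReplacement_both (hr : ∀ i, Function.Injective (r i)) (hτ : Dominant r τ)
    (h : Minima r τ m a b) {y : X} (hya : IsReplacement r m a y) : ¬ IsReplacement r m b y :=
  fun hyb => lt_asymm (h.lt_of_isReplacement hr hτ hya).2 (hyb.1 a h.ne)

variable [DecidableEq X]

theorem dominant_insert (hr : ∀ i, Function.Injective (r i)) (hτ : Dominant r τ)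
    (h : Minima r τ m a b) {y : X} (hy : IsReplacement r m a y) : Dominant r (insert y τ) := by
  have hlt := (h.lt_of_isReplacement hr hτ hy).2
  intro t
  by_cases ht : ∀ i, i ≠ a → r i (m i) < r i t
  · refine ⟨a, fun s hs => ?_⟩
    rcases mem_insert.1 hs with rfl | hs
    · exact hy.2 t ht
    · exact (hy.2 t ht).trans (hlt.le.trans (h.le a s hs))
  · push Not at ht
    obtain ⟨i, hia, hi⟩ := ht
    refine ⟨i, fun s hs => ?_⟩
    rcases mem_insert.1 hs with rfl | hs
    · exact hi.trans (hy.1 i hia).le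
    · exact hi.trans (h.le i s hs)

/-- In the enlarged set `y` is the minimum in some order `j`, and each element of `τ` must be the
minimum in some other order. Giving up `j` loses no element, so `j` is one of the two orders sharing
a minimum. -/
theorem isReplacement_of_dominant_insert (hr : ∀ i, Function.Injective (r i))
    (h : Minima r τ m a b) {y : X} (hyτ : y ∉ τ) (hy : Dominant r (insert y τ)) :
    IsReplacement r m a y ∨ IsReplacement r m b y := by
  obtain ⟨j, hj⟩ := hy y
  have hord : ∀ i, ∃ k, k ≠ j ∧ m k = m i ∧ r k (m k) < r k y := by
    intro i
    obtain ⟨k, hk⟩ := hy (m i)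
    have hki : m k = m i := hr k (le_antisymm (h.le k _ (h.mem i))
      (hk _ (mem_insert_of_mem (h.mem k))))
    have hlt : r k (m k) < r k y := by
      rw [hki]
      refine lt_of_le_of_ne (hk y (mem_insert_self _ _)) fun he => hyτ ?_
      rw [← hr k he]; exact h.mem i
    refine ⟨k, ?_, hki, hlt⟩
    rintro rfl
    exact absurd hlt (not_lt.2 (hj _ (mem_insert_of_mem (h.mem k))))
  have hjab : j = a ∨ j = b := by
    obtain ⟨k, hkj, hk, -⟩ := hord j
    have := h.eq_or k j hk
    tauto
  have hrep : IsReplacement r m j y := by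
    have habove : ∀ i, i ≠ j → r i (m i) < r i y := by
      intro i hi
      obtain ⟨k, hkj, hk, hlt⟩ := hord i
      have := h.eq_or k i hk
      have hki : k = i := by grind
      rwa [← hki]
    refine ⟨habove, fun t ht => ?_⟩
    obtain ⟨i, hi⟩ := hy t
    by_cases hij : i = j
    · subst hij; exact hi y (mem_insert_self _ _)
    · exact absurd (ht i hij) (not_lt.2 (hi _ (mem_insert_of_mem (h.mem i))))
  rcases hjab with rfl | rfl
  · exact Or.inl hrep
  · exact Or.inr hrep

theorem dominant_insert_iff (hr : ∀ i, Function.Injective (r i)) (hτ : Dominant r τ)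
    (h : Minima r τ m a b) {y : X} :
    (y ∉ τ ∧ Dominant r (insert y τ)) ↔ IsReplacement r m a y ∨ IsReplacement r m b y := by
  refine ⟨fun hy => h.isReplacement_of_dominant_insert hr hy.1 hy.2, ?_⟩
  rintro (hy | hy)
  · exact ⟨(h.lt_of_isReplacement hr hτ hy).1, h.dominant_insert hr hτ hy⟩
  · exact ⟨(h.symm.lt_of_isReplacement hr hτ hy).1, h.symm.dominant_insert hr hτ hy⟩

end Minima

/-! ### Parity counts and Scarf's lemma -/

variable [DecidableEq X]

/-- The supersets of `τ` with one more element correspond to the elements outside `τ`. -/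
theorem card_supersets_eq [Fintype X] (τ : Finset X) (P : Finset X → Prop) [DecidablePred P] :
    (univ.filter fun S : Finset X => (P S ∧ S.card = τ.card + 1) ∧ τ ⊆ S).card =
      (univ.filter fun y => y ∉ τ ∧ P (insert y τ)).card := by
  symm
  refine card_bij (fun y _ => insert y τ) ?_ ?_ ?_
  · intro y hy
    simp only [mem_filter, mem_univ, true_and] at hy ⊢
    exact ⟨⟨hy.2, card_insert_of_notMem hy.1⟩, subset_insert _ _⟩
  · intro y hy z hz hyz
    simp only [mem_filter, mem_univ, true_and] at hy hz
    have : y ∈ insert z τ := hyz ▸ mem_insert_self y τ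
    exact (mem_insert.1 this).resolve_right hy.1
  · intro S hS
    simp only [mem_filter, mem_univ, true_and] at hS
    obtain ⟨y, hy, rfl⟩ := exists_eq_insert_iff.2 ⟨hS.2, hS.1.2.symm⟩
    exact ⟨y, by simpa using ⟨hy, hS.1.1⟩, rfl⟩

/-- A set that misses a colour has an even number of facets carrying exactly the other colours. -/
theorem even_card_facets [Fintype X] [Fintype ι] [DecidableEq ι] (c : X → ι) (i₀ : ι)
    {S : Finset X} (hcard : S.card = Fintype.card ι) (hS : S.image c ≠ univ) :
    Even (univ.filter fun τ : Finset X =>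
      (τ.card + 1 = Fintype.card ι ∧ τ.image c = univ.erase i₀) ∧ τ ⊆ S).card := by
  rcases (univ.filter fun τ : Finset X =>
      (τ.card + 1 = Fintype.card ι ∧ τ.image c = univ.erase i₀) ∧ τ ⊆ S).eq_empty_or_nonempty
    with h | ⟨τ, hτ⟩
  · rw [h]; simp
  simp only [mem_filter, mem_univ, true_and] at hτ
  obtain ⟨⟨hτc, hτi⟩, hτS⟩ := hτ
  obtain ⟨y, hy, rfl⟩ := exists_eq_insert_iff.2 ⟨hτS, by omega⟩
  have hinj : Set.InjOn c τ := by
    rw [← card_image_iff, hτi, card_erase_of_mem (mem_univ _), card_univ]; omega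
  have hcy : c y ∈ τ.image c := by
    by_contra hcy
    apply hS
    rw [hτi] at hcy
    have : c y = i₀ := by simpa using hcy
    rw [image_insert, hτi, this, insert_erase (mem_univ i₀)]
  obtain ⟨z, hz, hzy⟩ := mem_image.1 hcy
  have hyz : y ≠ z := fun h => hy (h ▸ hz)
  -- The added `y` repeats the colour of exactly one `z` in `τ`, so the facets sought arise by
  -- deleting `y` or `z`.
  have hset : (univ.filter fun σ : Finset X => (σ.card + 1 = Fintype.card ι ∧
      σ.image c = univ.erase i₀) ∧ σ ⊆ insert y τ) = {τ, (insert y τ).erase z} := by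
    ext σ
    simp only [mem_filter, mem_univ, true_and, mem_insert, mem_singleton]
    constructor
    · rintro ⟨⟨hσc, hσi⟩, hσS⟩
      obtain ⟨w, hw, hwσ⟩ := exists_eq_insert_iff.2 ⟨hσS, by omega⟩
      have hσ : σ = (insert y τ).erase w := by rw [← hwσ, erase_insert hw]
      have hwS : w ∈ insert y τ := by rw [← hwσ]; exact mem_insert_self _ _
      rcases mem_insert.1 hwS with rfl | hwτ
      · left; rw [hσ, erase_insert hy]
      · right
        have hcw : c w ∈ σ.image c := by
          rw [hσi, ← hτi]; exact mem_image_of_mem c hwτ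
        obtain ⟨u, hu, huw⟩ := mem_image.1 hcw
        have huw' : u ≠ w := fun h => hw (h ▸ hu)
        rcases mem_insert.1 (hσS hu) with rfl | huτ
        · rw [hσ, hinj hz hwτ (hzy.trans huw)]
        · exact absurd (hinj huτ hwτ huw) huw'
    · rintro (rfl | rfl)
      · exact ⟨⟨hτc, hτi⟩, subset_insert _ _⟩
      · refine ⟨⟨?_, ?_⟩, erase_subset _ _⟩
        · rw [card_erase_of_mem (mem_insert_of_mem hz), hcard]
          omega
        · rw [← hτi]
          ext k
          simp only [mem_image, mem_erase, mem_insert]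
          constructor
          · rintro ⟨x, ⟨-, rfl | hx⟩, rfl⟩
            · exact ⟨z, hz, hzy⟩
            · exact ⟨x, hx, rfl⟩
          · rintro ⟨x, hx, rfl⟩
            by_cases hxz : x = z
            · exact ⟨y, ⟨hyz, Or.inl rfl⟩, by rw [hxz, hzy]⟩
            · exact ⟨x, ⟨hxz, Or.inr hx⟩, rfl⟩
  rw [hset, card_pair]
  · exact even_two
  · intro h
    rw [h] at hz
    simp at hz

/-- `e i` is the least element in the order `i`, and the other `e j` are above every element
outside the range of `e`. -/
structure IsSlack (r : ι → X → L) (e : ι → X) : Prop where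
  le : ∀ i x, r i (e i) ≤ r i x
  lt : ∀ i j, j ≠ i → ∀ x, x ∉ Set.range e → r i x < r i (e j)

theorem IsSlack.dominant_image_erase [Fintype ι] [DecidableEq ι] {e : ι → X} (he : IsSlack r e) (i₀ : ι) :
    Dominant r ((univ.erase i₀).image e) := by
  intro x
  by_cases hx : x ∈ Set.range e
  · obtain ⟨k, rfl⟩ := hx
    exact ⟨k, fun s _ => he.le k s⟩
  · refine ⟨i₀, fun s hs => ?_⟩
    obtain ⟨j, hj, rfl⟩ := mem_image.1 hs
    exact (he.lt i₀ j (mem_erase.1 hj).1 x hx).le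

section Parity

variable [Fintype X] [Fintype ι] [DecidableEq ι] {e : ι → X} {c : X → ι} {τ : Finset X}
  {m : ι → X} {a b : ι}

/-- Away from the slack facet both replacements exist, since `e a` and `e b` are themselves
candidates. The only obstruction is a minimum `m i = e k` with `k ≠ i`, which forces `τ` to consist
of slack elements; the colours then make it the excluded facet. -/
theorem exists_two_extensions (hr : ∀ i, Function.Injective (r i)) (he : IsSlack r e)
    (hc : ∀ i, c (e i) = i) (i₀ : ι) (hτ : Dominant r τ) (hcard : τ.card + 1 = Fintype.card ι)
    (hcol : τ.image c = univ.erase i₀) (hne : τ ≠ (univ.erase i₀).image e)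
    (h : Minima r τ m a b) :
    ∃ y z, y ≠ z ∧ ∀ x, (x ∉ τ ∧ Dominant r (insert x τ)) ↔ x = y ∨ x = z := by
  have hinj : Function.Injective e := Function.LeftInverse.injective hc
  have habove : ∀ j i, i ≠ j → r i (m i) < r i (e j) := by
    intro j i hij
    by_cases hm : m i ∈ Set.range e
    · obtain ⟨k, hk⟩ := hm
      by_cases hki : k = i
      · subst hki
        rw [← hk]
        exact lt_of_le_of_ne (he.le _ _) fun h' => hij (hinj (hr _ h'))
      · exfalso
        apply hne
        have hsub : τ ⊆ (univ.erase i).image e := by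
          intro s hs
          have hle := h.le i s hs
          rw [← hk] at hle
          by_cases hsr : s ∈ Set.range e
          · obtain ⟨l, rfl⟩ := hsr
            refine mem_image_of_mem _ (mem_erase.2 ⟨?_, mem_univ _⟩)
            rintro rfl
            exact hki (hinj (hr _ (le_antisymm hle (he.le _ _))))
          · exact absurd (he.lt i k hki s hsr) (not_lt.2 hle)
        have heq : τ = (univ.erase i).image e := by
          refine eq_of_subset_of_card_le hsub ?_
          rw [card_image_of_injective _ hinj, card_erase_of_mem (mem_univ _), card_univ]
          omega
        have : univ.erase i = univ.erase i₀ := by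
          rw [← hcol, heq, image_image]
          simp [Function.comp_def, hc]
        have hii : i = i₀ := by
          by_contra hii
          have : i ∈ univ.erase i := by rw [this]; simpa using hii
          simp at this
        rw [heq, hii]
    · exact he.lt i j hij.symm _ hm
  obtain ⟨y, hy⟩ := exists_isReplacement (habove a)
  obtain ⟨z, hz⟩ := exists_isReplacement (habove b)
  refine ⟨y, z, ?_, fun x => ?_⟩
  · rintro rfl
    exact h.not_isReplacement_both hr hτ hy hz
  · rw [h.dominant_insert_iff hr hτ]
    constructor
    · rintro (hx | hx)
      · exact Or.inl (hx.unique hr hy)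
      · exact Or.inr (hx.unique hr hz)
    · rintro (rfl | rfl)
      · exact Or.inl hy
      · exact Or.inr hz

/-- This is the boundary facet from which the parity argument gets its odd term. One of the two
orders sharing a minimum is `i₀`; a replacement in the other would have to be a slack element, and
none qualifies. -/
theorem exists_unique_extension (hr : ∀ i, Function.Injective (r i)) (he : IsSlack r e)
    (hinj : Function.Injective e) (i₀ : ι) {x₀ : X} (hx₀ : x₀ ∉ Set.range e)
    (h : Minima r ((univ.erase i₀).image e) m a b) :
    ∃ y, ∀ x, (x ∉ (univ.erase i₀).image e ∧
      Dominant r (insert x ((univ.erase i₀).image e))) ↔ x = y := by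
  have hm : ∀ i, i ≠ i₀ → m i = e i := fun i hi =>
    hr i (le_antisymm (h.le i _ (mem_image_of_mem _ (by simpa using hi))) (he.le _ _))
  obtain ⟨a, b, rfl, h⟩ : ∃ a b, a = i₀ ∧
      Minima r ((univ.erase i₀).image e) m a b := by
    by_cases hai : a = i₀
    · exact ⟨a, b, hai, h⟩
    by_cases hbi : b = i₀
    · exact ⟨b, a, hbi, h.symm⟩
    · have := h.eq
      rw [hm a hai, hm b hbi] at this
      exact absurd (hinj this) h.ne
  obtain ⟨y, hy⟩ : ∃ y, IsReplacement r m a y := by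
    refine exists_isReplacement (y := x₀) fun i hi => ?_
    rw [hm i hi]
    exact lt_of_le_of_ne (he.le _ _) fun h' => hx₀ ⟨i, hr i h'⟩
  refine ⟨y, fun x => ?_⟩
  rw [h.dominant_insert_iff hr (he.dominant_image_erase a)]
  constructor
  · rintro (hx | hx)
    · exact hx.unique hr hy
    · exfalso
      have h1 := hx.1 a h.ne
      rw [h.eq, hm b h.ne.symm] at h1
      have hxr : x ∈ Set.range e := by
        by_contra hxr
        exact lt_asymm h1 (he.lt a b h.ne.symm x hxr)
      obtain ⟨k, rfl⟩ := hxr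
      have hka : k ≠ a := by
        rintro rfl
        exact absurd h1 (not_lt.2 (he.le _ _))
      have hkb : k ≠ b := by
        rintro rfl
        exact lt_irrefl _ h1
      have h2 := hx.1 k hkb
      rw [hm k hka] at h2
      exact lt_irrefl _ h2
  · rintro rfl
    exact Or.inl hy

/-- **Scarf's lemma** on dominant sets, with colours. -/
theorem exists_dominant_image_eq_univ [Nontrivial ι] (hr : ∀ i, Function.Injective (r i))
    (he : IsSlack r e) (hc : ∀ i, c (e i) = i) (hx : ∃ x, x ∉ Set.range e) :
    ∃ S : Finset X, Dominant r S ∧ S.image c = univ := by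
  classical
  obtain ⟨x₀, hx₀⟩ := hx
  have hinj : Function.Injective e := Function.LeftInverse.injective hc
  obtain ⟨i₀⟩ : Nonempty ι := inferInstance
  have hn : 1 < Fintype.card ι := Fintype.one_lt_card
  by_contra! hno
  let D : Finset (Finset X) := univ.filter fun τ =>
    Dominant r τ ∧ τ.card + 1 = Fintype.card ι ∧ τ.image c = univ.erase i₀
  let R : Finset (Finset X) := univ.filter fun S => Dominant r S ∧ S.card = Fintype.card ι
  -- Incidences are counted twice. Without a fully coloured dominant set, every set in `R`
  -- contributes an even number, whereas among the facets in `D` only `τ₀` contributes an odd one.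
  have hcount := sum_card_bipartiteAbove_eq_sum_card_bipartiteBelow
    (s := D) (t := R) (fun τ S => τ ⊆ S)
  have hR : Even (∑ S ∈ R, (bipartiteBelow (fun τ S => τ ⊆ S) D S).card) := by
    refine even_sum _ fun S hS => ?_
    simp only [R, mem_filter, mem_univ, true_and] at hS
    refine (congrArg (fun F => Even (card F)) ?_).mpr (even_card_facets c i₀ hS.2 (hno S hS.1))
    ext τ
    simp only [bipartiteBelow, D, mem_filter, mem_univ, true_and]
    exact ⟨fun h => ⟨h.1.2, h.2⟩, fun h => ⟨⟨hS.1.mono h.2, h.1⟩, h.2⟩⟩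
  have habove : ∀ τ ∈ D, (bipartiteAbove (fun τ S => τ ⊆ S) R τ).card =
      (univ.filter fun y => y ∉ τ ∧ Dominant r (insert y τ)).card := by
    intro τ hτ
    simp only [D, mem_filter, mem_univ, true_and] at hτ
    rw [← card_supersets_eq, hτ.2.1, bipartiteAbove, filter_filter]
  have hmin : ∀ τ ∈ D, ∃ m a b, Minima r τ m a b := by
    intro τ hτ
    simp only [D, mem_filter, mem_univ, true_and] at hτ
    exact hτ.1.exists_minima hr (card_pos.1 (by omega)) hτ.2.1
  let τ₀ : Finset X := (univ.erase i₀).image e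
  have hτ₀ : τ₀ ∈ D := by
    simp only [D, mem_filter, mem_univ, true_and]
    refine ⟨he.dominant_image_erase i₀, ?_, ?_⟩
    · rw [card_image_of_injective _ hinj, card_erase_of_mem (mem_univ _), card_univ]
      omega
    · rw [image_image]
      simp [Function.comp_def, hc]
  have hone : (bipartiteAbove (fun τ S => τ ⊆ S) R τ₀).card = 1 := by
    rw [habove τ₀ hτ₀]
    obtain ⟨m, a, b, h⟩ := hmin τ₀ hτ₀
    obtain ⟨y, hy⟩ := exists_unique_extension hr he hinj i₀ hx₀ h
    rw [card_eq_one]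
    refine ⟨y, ?_⟩
    ext x
    rw [mem_filter, mem_singleton, ← hy x]
    simp only [mem_univ, true_and, τ₀]
  have htwo : ∀ τ ∈ D.erase τ₀, Even (bipartiteAbove (fun τ S => τ ⊆ S) R τ).card := by
    intro τ hτ
    obtain ⟨hne, hτ⟩ := mem_erase.1 hτ
    rw [habove τ hτ]
    obtain ⟨m, a, b, h⟩ := hmin τ hτ
    simp only [D, mem_filter, mem_univ, true_and] at hτ
    obtain ⟨y, z, hyz, hiff⟩ :=
      exists_two_extensions hr he hc i₀ hτ.1 hτ.2.1 hτ.2.2 hne h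
    have : (univ.filter fun y => y ∉ τ ∧ Dominant r (insert y τ)) = {y, z} := by
      ext x
      simpa using hiff x
    rw [this, card_pair hyz]
    exact even_two
  rw [← hcount, ← add_sum_erase D _ hτ₀, hone] at hR
  have := even_sum _ htwo
  rw [Nat.even_add] at hR
  simp [this] at hR

end Parity

end Scarf

/-! ### A discrete KKM lemma on the simplicial grid -/

namespace Scarf

open Finset

/-- The value in the order `i` of a grid point or of the slack element of `j`. -/
def gridValue {ι : Type*} [DecidableEq ι] {T : Type*} (N : ℕ) (p : T → ι → ℕ) (i : ι) :
    T ⊕ ι → ℕ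
  | .inl t => p t i + 1
  | .inr j => if j = i then 0 else N + 2

/-- A discrete form of the Knaster–Kuratowski–Mazurkiewicz lemma: in a coloured simplicial grid
there is a point `p` such that every colour `i` with `p i` not small occurs close to `p`. -/
theorem exists_grid_point {ι : Type*} [Fintype ι] [Nontrivial ι] (N : ℕ) (c : (ι → ℕ) → ι) :
    ∃ p : ι → ℕ, ∑ i, p i = N ∧ ∀ i, p i < Fintype.card ι ∨
      ∃ q : ι → ℕ, ∑ k, q k = N ∧ c q = i ∧
        ∀ k, q k < p k + Fintype.card ι ∧ p k < q k + Fintype.card ι := by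
  classical
  let T := {t : ι → ℕ // t ∈ (univ : Finset ι).piAntidiag N}
  have hT : ∀ t : T, ∑ i, t.1 i = N := fun t => (mem_piAntidiag.1 t.2).1
  have mkT : ∀ t : ι → ℕ, ∑ i, t i = N → ∃ s : T, s.1 = t := fun t ht =>
    ⟨⟨t, mem_piAntidiag.2 ⟨ht, fun i _ => mem_univ i⟩⟩, rfl⟩
  let idx := Fintype.equivFin (T ⊕ ι)
  -- The index breaks ties, making every order injective. Grid values lie in `[1, N + 1]`, strictly
  -- between the slack values `0` and `N + 2`.
  let r : ι → T ⊕ ι → ℕ ×ₗ Fin (Fintype.card (T ⊕ ι)) := fun i x =>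
    toLex (gridValue N Subtype.val i x, idx x)
  have hr : ∀ i, Function.Injective (r i) := fun i x y hxy =>
    idx.injective (congrArg (fun z => (ofLex z).2) hxy)
  have hr_lt : ∀ i x y, gridValue N Subtype.val i x < gridValue N Subtype.val i y →
      r i x < r i y := fun i x y hxy => Prod.Lex.toLex_lt_toLex.2 (Or.inl hxy)
  have hr_le : ∀ i x y, r i x ≤ r i y →
      gridValue N Subtype.val i x ≤ gridValue N Subtype.val i y := by
    intro i x y hxy
    by_contra! h
    exact absurd (hr_lt i y x h) (not_lt.2 hxy)
  have he : IsSlack r (Sum.inr : ι → T ⊕ ι) := by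
    constructor
    · rintro i (t | j)
      · exact (hr_lt _ _ _ (by simp [gridValue])).le
      · by_cases hj : j = i
        · rw [hj]
        · exact (hr_lt _ _ _ (by simp [gridValue, hj])).le
    · rintro i j hj (t | k) hx
      · refine hr_lt _ _ _ ?_
        have : t.1 i ≤ N := by
          exact (single_le_sum (fun _ _ => Nat.zero_le _) (mem_univ i)).trans_eq (hT t)
        simp only [gridValue, if_neg hj]
        omega
      · exact absurd ⟨k, rfl⟩ hx
  obtain ⟨i₀⟩ : Nonempty ι := inferInstance
  obtain ⟨t₀, -⟩ := mkT (Pi.single i₀ N) (by simp)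
  obtain ⟨S, hS, hcol⟩ := exists_dominant_image_eq_univ (c := Sum.elim (fun t : T => c t.1) id)
    hr he (fun i => rfl) ⟨Sum.inl t₀, by simp⟩
  have hdom : ∀ t : T, ∃ i, Sum.inr i ∉ S ∧ ∀ s : T, Sum.inl s ∈ S → t.1 i ≤ s.1 i := by
    intro t
    obtain ⟨i, hi⟩ := hS (Sum.inl t)
    refine ⟨i, fun hiS => ?_, fun s hs => ?_⟩
    · have := hr_le _ _ _ (hi _ hiS)
      simp [gridValue] at this
    · have := hr_le _ _ _ (hi _ hs)
      simpa [gridValue] using this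
  have hex : ∀ i, Sum.inr i ∉ S → ∃ s : T, Sum.inl s ∈ S ∧ c s.1 = i := by
    intro i hi
    obtain ⟨x, hx, hxi⟩ := mem_image.1 (hcol ▸ mem_univ i)
    rcases x with s | j
    · exact ⟨s, hx, hxi⟩
    · have hji : j = i := hxi
      exact absurd (hji ▸ hx) hi
  let C : Finset ι := univ.filter fun i => Sum.inr i ∉ S
  let P : Finset T := univ.filter fun s => Sum.inl s ∈ S
  obtain ⟨i₁, hi₁, -⟩ := hdom t₀
  obtain ⟨p, hp, -⟩ := hex i₁ hi₁
  have hpP : p ∈ P := by simpa [P] using hp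
  choose w hwP hw using fun i => exists_min_image P (fun s : T => s.1 i) ⟨p, hpP⟩
  let μ : ι → ℕ := fun i => (w i).1 i
  have hμ : ∀ i, ∀ s ∈ P, μ i ≤ s.1 i := fun i s hs => hw i s hs
  -- Otherwise the grid has room for a point exceeding `μ` in every coordinate of `C`, against
  -- dominance; the unused mass is put on `i₀`. This bound is what makes the points of `P` close
  -- together.
  have hsum : N < ∑ i ∈ C, μ i + C.card := by
    by_contra! hle
    let u : ι → ℕ := fun i => if i ∈ C then μ i + 1 else 0
    have hu : ∑ i, u i = ∑ i ∈ C, μ i + C.card := by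
      simp only [u, sum_ite_mem, univ_inter, sum_add_distrib, sum_const, smul_eq_mul, mul_one]
    obtain ⟨t, ht⟩ := mkT (u + Pi.single i₀ (N - ∑ i, u i)) (by
      simp only [Pi.add_apply, sum_add_distrib, sum_pi_single', mem_univ, if_true]
      omega)
    obtain ⟨i, hiS, hi⟩ := hdom t
    have hiC : i ∈ C := by simpa [C] using hiS
    have h1 := hi (w i) (by simpa [P] using hwP i)
    have h2 : μ i + 1 ≤ t.1 i := by
      rw [ht]
      simp [u, hiC]
    have : μ i = (w i).1 i := rfl
    omega
  have hCcard : C.card ≤ Fintype.card ι := card_le_univ C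
  have hC : ∀ s ∈ P, ∀ i ∈ C, s.1 i < μ i + Fintype.card ι := by
    intro s hs i hi
    have h1 : ∑ k ∈ C, s.1 k ≤ N :=
      (sum_le_sum_of_subset (subset_univ C)).trans_eq (hT s)
    have h2 : ∑ k ∈ C.erase i, μ k ≤ ∑ k ∈ C.erase i, s.1 k :=
      sum_le_sum fun k _ => hμ k s hs
    rw [← add_sum_erase C _ hi] at h1 hsum
    omega
  have hCc : ∀ s ∈ P, ∀ i ∉ C, s.1 i < Fintype.card ι := by
    intro s hs i hi
    have h1 : ∑ k ∈ insert i C, s.1 k ≤ N :=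
      (sum_le_sum_of_subset (subset_univ _)).trans_eq (hT s)
    rw [sum_insert hi] at h1
    have h2 : ∑ k ∈ C, μ k ≤ ∑ k ∈ C, s.1 k := sum_le_sum fun k _ => hμ k s hs
    omega
  have hclose : ∀ s ∈ P, ∀ s' ∈ P, ∀ i, s.1 i < s'.1 i + Fintype.card ι := by
    intro s hs s' hs' i
    by_cases hi : i ∈ C
    · have := hC s hs i hi
      have := hμ i s' hs'
      omega
    · have := hCc s hs i hi
      omega
  refine ⟨p.1, hT p, fun i => ?_⟩
  by_cases hi : i ∈ C
  · obtain ⟨s, hs, hsi⟩ := hex i (by simpa [C] using hi)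
    have hsP : s ∈ P := by simpa [P] using hs
    exact Or.inr ⟨s.1, hT s, hsi, fun k => ⟨hclose s hsP p hpP k, hclose p hpP s hsP k⟩⟩
  · exact Or.inl (hCc p hpP i hi)

end Scarf

/-! ### Brouwer's theorem by compactness -/

open Filter Topology in
/-- **Brouwer's fixed point theorem** on the standard simplex. -/
theorem exists_fixedPoint_stdSimplex {ι : Type*} [Fintype ι] [Nontrivial ι]
    (f : (ι → ℝ) → ι → ℝ) (hf : ContinuousOn f (stdSimplex ℝ ι))
    (hmaps : Set.MapsTo f (stdSimplex ℝ ι) (stdSimplex ℝ ι)) :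
    ∃ x ∈ stdSimplex ℝ ι, f x = x := by
  classical
  set n : ℝ := (Fintype.card ι : ℝ) with hn
  -- A point is coloured by a coordinate that `f` does not decrease; one exists because both
  -- coordinate sums are `1`.
  have hcol : ∀ z : ι → ℝ, ∃ i, z ∈ stdSimplex ℝ ι → z i ≤ f z i := by
    intro z
    by_cases hz : z ∈ stdSimplex ℝ ι
    · obtain ⟨i, -, hi⟩ := Finset.exists_le_of_sum_le (s := Finset.univ) (f := z) (g := f z)
        Finset.univ_nonempty (by rw [hz.2, (hmaps hz).2])
      exact ⟨i, fun _ => hi⟩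
    · exact ⟨Classical.arbitrary ι, fun h => absurd h hz⟩
  choose c hc using hcol
  let sc : ℕ → (ι → ℕ) → ι → ℝ := fun N q k => (q k : ℝ) / (N + 1)
  have hsc : ∀ N q, ∑ k, q k = N + 1 → sc N q ∈ stdSimplex ℝ ι := by
    intro N q hq
    refine ⟨fun k => by positivity, ?_⟩
    rw [← Finset.sum_div, ← Nat.cast_sum, hq, Nat.cast_add_one, div_self (by positivity)]
  choose p hpsum hp using fun N : ℕ =>
    Scarf.exists_grid_point (N + 1) (fun q => c (sc N q))
  obtain ⟨x, hx, φ, hφ, hlim⟩ := (isCompact_stdSimplex ℝ ι).tendsto_subseq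
    (fun N => hsc N (p N) (hpsum N))
  have hsmall : Tendsto (fun N : ℕ => n / ((φ N : ℝ) + 1)) atTop (𝓝 0) := by
    have h := (tendsto_one_div_add_atTop_nhds_zero_nat (𝕜 := ℝ)).const_mul n
    simp only [mul_zero, mul_one_div] at h
    exact h.comp hφ.tendsto_atTop
  -- If `f` decreased coordinate `i` at `x`, it would do so nearby. But `x i > 0` rules out small `p
  -- i` for large `N`, so a point of colour `i` lies arbitrarily near `x`.
  have hge : ∀ i, x i ≤ f x i := by
    intro i
    by_contra! hlt
    have hxi : 0 < x i := ((hmaps hx).1 i).trans_lt hlt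
    have hfi : ContinuousWithinAt (fun z => f z i) (stdSimplex ℝ ι) x :=
      (continuous_apply i).continuousAt.comp_continuousWithinAt (hf x hx)
    have hzi : ContinuousWithinAt (fun z : ι → ℝ => z i) (stdSimplex ℝ ι) x :=
      (continuous_apply i).continuousWithinAt
    have hev : ∀ᶠ z in 𝓝[stdSimplex ℝ ι] x, f z i < z i := hfi.eventually_lt hzi hlt
    obtain ⟨δ, hδ, hball⟩ := Metric.mem_nhdsWithin_iff.1 hev
    have h1 : ∀ᶠ N in atTop, dist (sc (φ N) (p (φ N))) x < δ / 2 :=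
      Metric.tendsto_nhds.1 hlim _ (half_pos hδ)
    have h2 : ∀ᶠ N : ℕ in atTop, n / ((φ N : ℝ) + 1) < δ / 2 :=
      hsmall.eventually_lt_const (half_pos hδ)
    have h3 : ∀ᶠ N : ℕ in atTop, n / ((φ N : ℝ) + 1) < sc (φ N) (p (φ N)) i :=
      hsmall.eventually_lt (((continuous_apply i).tendsto x).comp hlim) hxi
    obtain ⟨N, hN1, hN2, hN3⟩ := (h1.and (h2.and h3)).exists
    have hpos : (0 : ℝ) < (φ N : ℝ) + 1 := by positivity
    rcases hp (φ N) i with hi | ⟨q, hq, hqi, hqk⟩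
    · simp only [sc] at hN3
      rw [div_lt_div_iff_of_pos_right hpos, hn, Nat.cast_lt] at hN3
      exact lt_asymm hi hN3
    · have hdist : dist (sc (φ N) q) (sc (φ N) (p (φ N))) ≤ n / ((φ N : ℝ) + 1) := by
        refine (dist_pi_le_iff (by positivity)).2 fun k => ?_
        obtain ⟨hk1, hk2⟩ := hqk k
        have hk1' : (q k : ℝ) < p (φ N) k + n := by rw [hn]; exact_mod_cast hk1
        have hk2' : (p (φ N) k : ℝ) < q k + n := by rw [hn]; exact_mod_cast hk2
        simp only [sc]
        rw [Real.dist_eq, ← sub_div, abs_div, abs_of_pos hpos, div_le_div_iff_of_pos_right hpos,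
          abs_le]
        constructor <;> linarith
      have hqS := hsc (φ N) q hq
      have hlt' : f (sc (φ N) q) i < sc (φ N) q i := by
        refine hball ⟨?_, hqS⟩
        rw [Metric.mem_ball]
        linarith [dist_triangle (sc (φ N) q) (sc (φ N) (p (φ N))) x]
      have := hc _ hqS
      rw [hqi] at this
      exact absurd hlt' (not_lt.2 this)
  refine ⟨x, hx, ?_⟩
  have heq := (Finset.sum_eq_sum_iff_of_le (fun i _ => hge i)).1
    (by rw [hx.2, (hmaps hx).2] : ∑ i, x i = ∑ i, f x i)
  exact funext fun i => (heq i (Finset.mem_univ i)).symm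

/-- A continuous map whose values are nonnegative with coordinate sum at most `1` has a fixed
point. -/
theorem exists_fixedPoint_of_sum_le_one {V : Type*} [Fintype V] (f : (V → ℝ) → V → ℝ)
    (hf : Continuous f) (hnn : ∀ x v, 0 ≤ f x v) (hsum : ∀ x, ∑ v, f x v ≤ 1) :
    ∃ x, f x = x := by
  rcases isEmpty_or_nonempty V with hV | hV
  · exact ⟨0, Subsingleton.elim _ _⟩
  -- The coordinate `none` carries the mass missing from `1`.
  let F : (Option V → ℝ) → Option V → ℝ := fun y o =>
    o.elim (1 - ∑ v, f (fun w => y (some w)) v) (f fun w => y (some w))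
  have hF : Continuous F := by
    refine continuous_pi fun o => ?_
    cases o with
    | none => simp only [F, Option.elim]; fun_prop
    | some v => simp only [F, Option.elim]; fun_prop
  obtain ⟨y, -, hy⟩ := exists_fixedPoint_stdSimplex F hF.continuousOn (by
    intro y _
    refine ⟨fun o => ?_, by simp [F, Fintype.sum_option]⟩
    cases o with
    | none => simpa [F] using hsum _
    | some v => exact hnn _ v)
  exact ⟨fun w => y (some w), funext fun v => congrFun hy (some v)⟩

/-! ### Continuous gates and the fixed point -/

namespace GeneralizedCircuit

/-- A continuous function that separates the boolean values `0` and `1`. -/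
theorem exists_continuous_threshold {M : ℝ} (hM : 0 < M) (ε : ℝ) (hε : 0 < ε) :
    ∃ h : ℝ → ℝ, Continuous h ∧ (∀ a, 0 ≤ h a ∧ h a ≤ M) ∧
      (∀ a ≤ ε, h a ≤ ε) ∧ ∀ a, M - ε ≤ a → M - ε ≤ h a := by
  rcases lt_or_ge (2 * ε) M with h | h
  · have hd : 0 < M - 2 * ε := by linarith
    refine ⟨fun a => max 0 (min M (M * ((a - ε) / (M - 2 * ε)))), by fun_prop,
      fun a => ⟨le_max_left _ _, max_le hM.le (min_le_left _ _)⟩, fun a ha => ?_, fun a ha => ?_⟩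
    · refine max_le hε.le ((min_le_right _ _).trans (le_trans ?_ hε.le))
      exact mul_nonpos_of_nonneg_of_nonpos hM.le
        (div_nonpos_of_nonpos_of_nonneg (by linarith) hd.le)
    · refine le_max_of_le_right (le_min (by linarith) ?_)
      have : 1 ≤ (a - ε) / (M - 2 * ε) := by rw [le_div_iff₀ hd]; linarith
      nlinarith
  -- When `M ≤ 2 * ε` the ranges for `0` and `1` overlap, and the constant `M / 2` represents both.
  · exact ⟨fun _ => M / 2, continuous_const, fun _ => ⟨by linarith, by linarith⟩,
      fun _ _ => by linarith, fun _ _ => by linarith⟩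

/-- A continuous comparison of two reals with precision `ε`. -/
theorem exists_continuous_compare {M : ℝ} (hM : 0 < M) {ε : ℝ} (hε : 0 < ε) :
    ∃ h : ℝ → ℝ, Continuous h ∧ (∀ d, 0 ≤ h d ∧ h d ≤ M) ∧
      (∀ d, d ≤ -ε → h d = 0) ∧ ∀ d, ε ≤ d → h d = M := by
  refine ⟨fun d => max 0 (min M (M * ((d + ε) / (2 * ε)))), by fun_prop,
    fun a => ⟨le_max_left _ _, max_le hM.le (min_le_left _ _)⟩, fun a ha => ?_, fun a ha => ?_⟩
  · refine max_eq_left ((min_le_right _ _).trans ?_)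
    exact mul_nonpos_of_nonneg_of_nonpos hM.le
      (div_nonpos_of_nonpos_of_nonneg (by linarith) (by linarith))
  · have : 1 ≤ (a + ε) / (2 * ε) := by rw [le_div_iff₀ (by linarith)]; linarith
    have h1 : M ≤ M * ((a + ε) / (2 * ε)) := le_mul_of_one_le_right hM.le this
    simp only [min_eq_left h1, max_eq_right hM.le]

/-- Every valid gate can be implemented by a continuous function with values in `[0, 1/K]`. -/
theorem Gate.exists_continuous {V : Type*} [Fintype V] {T : Gate V} (hT : T.IsValid) {ε : ℝ}
    (hε : 0 < ε) :
    ∃ g : (V → ℝ) → ℝ, Continuous g ∧ (∀ x, 0 ≤ g x ∧ g x ≤ 1 / (Fintype.card V : ℝ)) ∧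
      ∀ x : V → ℝ, (∀ v, 0 ≤ x v) → x T.out = g x → T.Constraint ε x := by
  have hM : 0 < 1 / (Fintype.card V : ℝ) := by
    have : Nonempty V := ⟨T.out⟩
    positivity
  obtain ⟨h, hcont, hmem, hzero, hone⟩ := exists_continuous_threshold hM ε hε
  obtain ⟨type, fst, snd, v, param⟩ := T
  cases type
  case const =>
    obtain ⟨rfl, rfl, α, rfl, h0, h1⟩ := hT
    refine ⟨fun _ => α, continuous_const, fun _ => ⟨h0, h1⟩, fun x _ hx => ?_⟩
    change x v = α at hx
    simp only [Gate.Constraint, Approx, hx]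
    constructor <;> linarith
  case scale =>
    obtain ⟨⟨v₁, rfl⟩, rfl, α, rfl, h0, h1⟩ := hT
    -- The outer `max 0` keeps the function nonnegative on all of `V → ℝ`; it disappears at
    -- nonnegative assignments.
    refine ⟨fun x => max 0 (min (α * x v₁) (1 / (Fintype.card V : ℝ))), by fun_prop,
      fun x => ⟨le_max_left _ _, max_le hM.le (min_le_right _ _)⟩, fun x hnn hx => ?_⟩
    change x v = max 0 (min (α * x v₁) (1 / (Fintype.card V : ℝ))) at hx
    rw [max_eq_right (le_min (mul_nonneg h0 (hnn _)) hM.le)] at hx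
    simp only [Gate.Constraint, Approx, hx]
    constructor <;> linarith
  case copy =>
    obtain ⟨⟨v₁, rfl⟩, rfl, rfl⟩ := hT
    refine ⟨fun x => max 0 (min (x v₁) (1 / (Fintype.card V : ℝ))), by fun_prop,
      fun x => ⟨le_max_left _ _, max_le hM.le (min_le_right _ _)⟩, fun x hnn hx => ?_⟩
    change x v = max 0 (min (x v₁) (1 / (Fintype.card V : ℝ))) at hx
    rw [max_eq_right (le_min (hnn _) hM.le)] at hx
    simp only [Gate.Constraint, Approx, hx]
    constructor <;> linarith
  case plus =>
    obtain ⟨⟨v₁, v₂, rfl, rfl, -⟩, rfl⟩ := hT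
    refine ⟨fun x => max 0 (min (x v₁ + x v₂) (1 / (Fintype.card V : ℝ))), by fun_prop,
      fun x => ⟨le_max_left _ _, max_le hM.le (min_le_right _ _)⟩, fun x hnn hx => ?_⟩
    change x v = max 0 (min (x v₁ + x v₂) (1 / (Fintype.card V : ℝ))) at hx
    rw [max_eq_right (le_min (add_nonneg (hnn _) (hnn _)) hM.le)] at hx
    simp only [Gate.Constraint, Approx, hx]
    constructor <;> linarith
  case minus =>
    obtain ⟨⟨v₁, v₂, rfl, rfl, -⟩, rfl⟩ := hT
    refine ⟨fun x => max 0 (min (x v₁ - x v₂) (1 / (Fintype.card V : ℝ))), by fun_prop,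
      fun x => ⟨le_max_left _ _, max_le hM.le (min_le_right _ _)⟩, fun x _ hx => ?_⟩
    change x v = max 0 (min (x v₁ - x v₂) (1 / (Fintype.card V : ℝ))) at hx
    simp only [Gate.Constraint, hx]
    constructor
    · have := le_max_right 0 (min (x v₁ - x v₂) (1 / (Fintype.card V : ℝ)))
      linarith
    · have : max 0 (min (x v₁ - x v₂) (1 / (Fintype.card V : ℝ))) ≤ max (x v₁ - x v₂) 0 :=
        max_le (le_max_right _ _) ((min_le_left _ _).trans (le_max_left _ _))
      linarith
  case less =>
    obtain ⟨⟨v₁, v₂, rfl, rfl, -⟩, rfl⟩ := hT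
    obtain ⟨k, kcont, kmem, kzero, kone⟩ := exists_continuous_compare hM hε
    refine ⟨fun x => k (x v₂ - x v₁), by fun_prop, fun x => kmem _, fun x _ hx => ?_⟩
    change x v = k (x v₂ - x v₁) at hx
    simp only [Gate.Constraint, IsOne, IsZero]
    refine ⟨fun hlt => ?_, fun hlt => ?_⟩
    · rw [hx, kone _ (by linarith)]
      constructor <;> linarith
    · rw [hx, kzero _ (by linarith)]
      exact ⟨le_rfl, hε.le⟩
  case disj =>
    obtain ⟨⟨v₁, v₂, rfl, rfl, -⟩, rfl⟩ := hT
    refine ⟨fun x => max (h (x v₁)) (h (x v₂)), by fun_prop,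
      fun x => ⟨le_max_of_le_left (hmem _).1, max_le (hmem _).2 (hmem _).2⟩, fun x _ hx => ?_⟩
    change x v = max (h (x v₁)) (h (x v₂)) at hx
    have hle : x v ≤ 1 / (Fintype.card V : ℝ) := hx ▸ max_le (hmem _).2 (hmem _).2
    have hge : 0 ≤ x v := hx ▸ le_max_of_le_left (hmem _).1
    simp only [Gate.Constraint, IsOne, IsZero]
    refine ⟨fun H => ⟨?_, by linarith⟩, fun H => ⟨hge, ?_⟩⟩
    · rw [hx]
      exact H.elim (fun H => le_max_of_le_left (hone _ H.1))
        (fun H => le_max_of_le_right (hone _ H.1))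
    · rw [hx]
      exact max_le (hzero _ H.1.2) (hzero _ H.2.2)
  case conj =>
    obtain ⟨⟨v₁, v₂, rfl, rfl, -⟩, rfl⟩ := hT
    refine ⟨fun x => min (h (x v₁)) (h (x v₂)), by fun_prop,
      fun x => ⟨le_min (hmem _).1 (hmem _).1, min_le_of_left_le (hmem _).2⟩, fun x _ hx => ?_⟩
    change x v = min (h (x v₁)) (h (x v₂)) at hx
    have hle : x v ≤ 1 / (Fintype.card V : ℝ) := hx ▸ min_le_of_left_le (hmem _).2
    have hge : 0 ≤ x v := hx ▸ le_min (hmem _).1 (hmem _).1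
    simp only [Gate.Constraint, IsOne, IsZero]
    refine ⟨fun H => ⟨hge, ?_⟩, fun H => ⟨?_, by linarith⟩⟩
    · rw [hx]
      exact H.elim (fun H => min_le_of_left_le (hzero _ H.2))
        (fun H => min_le_of_right_le (hzero _ H.2))
    · rw [hx]
      exact le_min (hone _ H.1.1) (hone _ H.2.1)
  case neg =>
    obtain ⟨⟨v₁, rfl⟩, rfl, rfl⟩ := hT
    refine ⟨fun x => 1 / (Fintype.card V : ℝ) - h (x v₁), by fun_prop,
      fun x => ⟨by linarith [(hmem (x v₁)).2], by linarith [(hmem (x v₁)).1]⟩,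
      fun x hnn hx => ?_⟩
    change x v = 1 / (Fintype.card V : ℝ) - h (x v₁) at hx
    have h1 := hmem (x v₁)
    simp only [Gate.Constraint, IsOne, IsZero]
    refine ⟨fun H => ?_, fun H => ?_⟩
    · have := hone _ H.1
      exact ⟨hnn v, by linarith⟩
    · have := hzero _ H.2
      constructor <;> linarith

end GeneralizedCircuit

/-- A generalized circuit has an `ε`-approximate solution for every `ε > 0`. -/
theorem exists_isApproxSolution {V : Type*} [Fintype V] (S : GeneralizedCircuit.Circuit V) {ε : ℝ} (hε : 0 < ε) :
    ∃ x : V → ℝ, S.IsApproxSolution ε x := by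
  have hg : ∀ v : V, ∃ g : (V → ℝ) → ℝ, Continuous g ∧
      (∀ x, 0 ≤ g x ∧ g x ≤ 1 / (Fintype.card V : ℝ)) ∧
      ∀ T ∈ S.gates, T.out = v →
        ∀ x : V → ℝ, (∀ v, 0 ≤ x v) → x v = g x → T.Constraint ε x := by
    intro v
    by_cases h : ∃ T ∈ S.gates, T.out = v
    · obtain ⟨T, hT, rfl⟩ := h
      obtain ⟨g, hcont, hmem, hcons⟩ := GeneralizedCircuit.Gate.exists_continuous (S.valid T hT) hε
      refine ⟨g, hcont, hmem, fun T' hT' hout => ?_⟩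
      obtain rfl : T' = T := by
        by_contra hne
        exact S.out_ne T' hT' T hT hne hout
      exact hcons
    -- A node that is no gate's output is unconstrained and is set to `0`.
    · exact ⟨fun _ => 0, continuous_const, fun _ => ⟨le_rfl, by positivity⟩,
        fun T hT hout => absurd ⟨T, hT, hout⟩ h⟩
  choose g hcont hmem hcons using hg
  obtain ⟨x, hx⟩ := exists_fixedPoint_of_sum_le_one (fun x v => g v x) (continuous_pi hcont)
    (fun x v => (hmem v x).1) (fun x => by
      refine (Finset.sum_le_card_nsmul _ _ _ fun v _ => (hmem v x).2).trans ?_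
      rw [nsmul_eq_mul, Finset.card_univ, mul_one_div]
      exact div_self_le_one _)
  have hxv : ∀ v, x v = g v x := fun v => (congrFun hx v).symm
  have hnn : ∀ v, 0 ≤ x v := fun v => hxv v ▸ (hmem v x).1
  exact ⟨x, fun v => ⟨hnn v, by linarith [hxv v, (hmem v x).2]⟩,
    fun T hT => hcons T.out T hT rfl x hnn (hxv _)⟩

theorem theorem4p7 (c : ℝ) (hc : 0 < c) {V : Type*} [Fintype V]
    (S : GeneralizedCircuit.Circuit V) :
    ∃ x : V → ℝ, S.IsApproxSolution (1 / (Fintype.card V : ℝ) ^ c) x := by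
  rcases isEmpty_or_nonempty V with hV | hV
  · exact ⟨0, fun v => isEmptyElim v, fun T _ => isEmptyElim T.out⟩
  · exact exists_isApproxSolution S (by positivity)
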